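/- Let $G<\mathrm{SL}_4(\mathbb{C})$ be a finite subgroup that acts transitively on $\mathbb{C}^4$, i.e. the $G$-orbit of every non-zero vector spans $\mathbb{C}^4$, and let $\bar{G}$ be the image of $G$ under the natural projection $\mathrm{SL}_4(\mathbb{C})\to\mathrm{PGL}_4(\mathbb{C})$. By a surface of degree $d\geq 1$ in $\mathbb{P}^3=\mathbb{P}^3_{\mathbb{C}}$ we mean the zero locus of a squarefree homogeneous polynomial of degree $d$ in four variables (so surfaces are reduced, but may be reducible). Let $S\subset\mathbb{P}^3$ be a $\bar{G}$-invariant surface whose degree is minimal among the degrees of all $\bar{G}$-invariant surfaces in $\mathbb{P}^3$. Then either $\deg S\geq 4$ or $S$ is smooth. -/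

import Mathlib

open scoped LinearAlgebra.Projectivization MatrixGroups Matrix Pointwise

/-- `G` acts transitively on `ℂ⁴`: the orbit of every non-zero vector spans `ℂ⁴`. -/
def ActsTransitively (G : Subgroup (Matrix.SpecialLinearGroup (Fin 4) ℂ)) : Prop :=
  ∀ x : Fin 4 → ℂ, x ≠ 0 →
    Submodule.span ℂ {y | ∃ g ∈ G, y = (g : Matrix (Fin 4) (Fin 4) ℂ) *ᵥ x} = ⊤

/-- The zero locus in `ℙ³` of a polynomial (used for homogeneous polynomials only, where it does
not depend on the chosen representatives of the points). -/
def projZeroLocus (f : MvPolynomial (Fin 4) ℂ) : Set (ℙ ℂ (Fin 4 → ℂ)) :=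
  {p | MvPolynomial.eval p.rep f = 0}

/-- `f` is a reduced equation, of degree `d`, of the surface `S ⊂ ℙ³`: a squarefree homogeneous
polynomial of positive degree `d` with zero locus `S`. By the Nullstellensatz such an `f` generates
the homogeneous ideal of `S`, so that it is unique up to a non-zero scalar. -/
structure IsReducedEquation (f : MvPolynomial (Fin 4) ℂ) (d : ℕ)
    (S : Set (ℙ ℂ (Fin 4 → ℂ))) : Prop where
  pos : 0 < d
  homogeneous : f.IsHomogeneous d
  squarefree : Squarefree f
  zeroLocus : projZeroLocus f = S

/-- `S` is a (reduced, possibly reducible) algebraic surface of degree `d` in `ℙ³`. -/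
def IsSurfaceOfDegree (S : Set (ℙ ℂ (Fin 4 → ℂ))) (d : ℕ) : Prop :=
  ∃ f, IsReducedEquation f d S

/-- The surface `S ⊂ ℙ³` is smooth: at each of its points some partial derivative of its reduced
equation does not vanish. -/
def IsSmoothSurface (S : Set (ℙ ℂ (Fin 4 → ℂ))) : Prop :=
  ∃ f d, IsReducedEquation f d S ∧
    ∀ p ∈ S, ∃ i, MvPolynomial.eval p.rep (MvPolynomial.pderiv i f) ≠ 0

/-- `S` is invariant under the subgroup `H` of `PGL₄(ℂ)`: `h(S) = S` for all `h ∈ H`. -/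
def IsInvariantUnder (H : Subgroup (Matrix.ProjGenLinGroup (Fin 4) ℂ)) (S : Set (ℙ ℂ (Fin 4 → ℂ))) : Prop :=
  ∀ h ∈ H, h • S = S

/-! By the Nullstellensatz a reduced equation f of an invariant surface divides its translates, so G
scales f. Suppose deg f ≤ 3 and v is a singular point. For degrees 1 and 2, the polar form kills v,
hence the spanning orbit of v, so f = 0. For a cubic, the orbit of v contains a basis of singular
points, in which f is a combination of the four squarefree monomials. If a coefficient vanishes, f
vanishes on a coordinate plane, hence on four independent translates of it, too many for degree 3
(`IsSemiInvariant.eq_zero_of_vanishes_on_ker`). Otherwise f is, after rescaling, the Cayley cubic: G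
permutes its four nodes and fixes the line through their sum, against irreducibility
(`not_isSemiInvariant_cayley`). -/

section SymmetricTrilinear

variable {K V Γ : Type*} [Field K] [AddCommGroup V] [Module K V] [Group Γ]

/-! ### Spanning orbits and cubics containing a plane -/

/-- A spanning set contains a basis. -/
theorem exists_basis_mem_of_span_eq_top [FiniteDimensional K V] {n : ℕ}
    (hn : Module.finrank K V = n) {s : Set V} (hs : Submodule.span K s = ⊤) :
    ∃ b : Module.Basis (Fin n) K V, ∀ i, b i ∈ s := by
  let b := Module.Basis.ofSpan hs.ge
  have : Fintype _ := FiniteDimensional.fintypeBasisIndex b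
  have hc := Module.finrank_eq_card_basis b
  refine ⟨b.reindex (Fintype.equivFinOfCardEq (hc.symm.trans hn)), fun i => ?_⟩
  rw [Module.Basis.reindex_apply]
  exact Module.Basis.ofSpan_subset hs.ge ⟨_, rfl⟩

/-- Every orbit of a non-zero vector spans. -/
def SpanningOrbits (ρ : Representation K Γ V) : Prop :=
  ∀ x : V, x ≠ 0 → Submodule.span K (Set.range fun g => ρ g x) = ⊤

/-- The trilinear form `F` is multiplied by a scalar by each element of the group. -/
def IsSemiInvariant (ρ : Representation K Γ V) (F : V →ₗ[K] V →ₗ[K] V →ₗ[K] K) : Prop :=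
  ∀ g, ∃ c : K, ∀ u v w, F (ρ g u) (ρ g v) (ρ g w) = c * F u v w

/-- Otherwise some x ≠ 0 is killed by all translates of l, so l vanishes on the spanning orbit of x.
-/
theorem SpanningOrbits.dual [FiniteDimensional K V] {ρ : Representation K Γ V}
    (hρ : SpanningOrbits ρ) {l : Module.Dual K V} (hl : l ≠ 0) :
    Submodule.span K (Set.range fun g => l ∘ₗ ρ g) = ⊤ := by
  by_contra h
  obtain ⟨φ, hφ, hle⟩ := Submodule.exists_le_ker_of_lt_top _ (lt_top_iff_ne_top.2 h)
  obtain ⟨x, rfl⟩ := (Module.evalEquiv K V).surjective φ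
  have hx : x ≠ 0 := by rintro rfl; simp at hφ
  apply hl
  rw [← LinearMap.ker_eq_top, eq_top_iff, ← hρ x hx, Submodule.span_le]
  rintro _ ⟨g, rfl⟩
  have := hle (Submodule.subset_span ⟨g, rfl⟩)
  simpa using this

theorem SpanningOrbits.exists_dual_basis [FiniteDimensional K V] {n : ℕ}
    (hn : Module.finrank K V = n) {ρ : Representation K Γ V}
    (hρ : SpanningOrbits ρ) {l : Module.Dual K V} (hl : l ≠ 0) :
    ∃ (e : Module.Basis (Fin n) K V) (g : Fin n → Γ),
      ∀ i j, i ≠ j → l (ρ (g i) (e j)) = 0 := by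
  obtain ⟨b, hb⟩ := exists_basis_mem_of_span_eq_top
    (Subspace.dual_finrank_eq.trans hn) (hρ.dual hl)
  choose g hg using hb
  refine ⟨b.dualBasis.map (Module.evalEquiv K V).symm, g, fun i j hij => ?_⟩
  have h1 : l (ρ (g i) ((b.dualBasis.map (Module.evalEquiv K V).symm) j)) =
      b i ((b.dualBasis.map (Module.evalEquiv K V).symm) j) := by
    rw [← hg i]; rfl
  rw [h1, Module.Basis.map_apply, Module.apply_evalEquiv_symm_apply,
    Module.Basis.dualBasis_apply_self, if_neg hij]

/-- A semi-invariant trilinear form on a four-dimensional space which vanishes on a hyperplane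
is zero. -/
theorem IsSemiInvariant.eq_zero_of_vanishes_on_ker [FiniteDimensional K V]
    (hn : Module.finrank K V = 4) {ρ : Representation K Γ V} (hρ : SpanningOrbits ρ)
    {F : V →ₗ[K] V →ₗ[K] V →ₗ[K] K} (hF : IsSemiInvariant ρ F) {l : Module.Dual K V} (hl : l ≠ 0)
    (hv : ∀ u v w, l u = 0 → l v = 0 → l w = 0 → F u v w = 0) : F = 0 := by
  obtain ⟨e, g, he⟩ := hρ.exists_dual_basis hn hl
  refine e.ext fun i => e.ext fun j => e.ext fun k => ?_
  -- Three indices out of four miss some m, so `g m` moves all three basis vectors into the kernel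
  -- of l.
  obtain ⟨m, hmi, hmj, hmk⟩ : ∃ m : Fin 4, m ≠ i ∧ m ≠ j ∧ m ≠ k := by
    revert i j k; decide
  obtain ⟨c, hc⟩ := hF (g m)⁻¹
  have := hc (ρ (g m) (e i)) (ρ (g m) (e j)) (ρ (g m) (e k))
  rw [hv _ _ _ (he m i hmi) (he m j hmj) (he m k hmk), mul_zero] at this
  simpa using this

/-- A symmetric trilinear form which vanishes whenever two arguments are the same basis vector,
and on three distinct basis vectors, vanishes on their span. -/
theorem trilinear_vanishes_on_coord_ker
    {F : V →ₗ[K] V →ₗ[K] V →ₗ[K] K} (h12 : ∀ u v w, F u v w = F v u w)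
    (h23 : ∀ u v w, F u v w = F u w v) (e : Module.Basis (Fin 4) K V)
    (he : ∀ i w, F (e i) (e i) w = 0) {i j k m : Fin 4} (hij : i ≠ j) (hik : i ≠ k) (hjk : j ≠ k)
    (hmi : m ≠ i) (hmj : m ≠ j) (hmk : m ≠ k) (h0 : F (e i) (e j) (e k) = 0) (u v w : V)
    (hu : e.coord m u = 0) (hv : e.coord m v = 0) (hw : e.coord m w = 0) : F u v w = 0 := by
  have key : ∀ a b c : Fin 4, m ≠ a → m ≠ b → m ≠ c → F (e a) (e b) (e c) = 0 := by
    intro a b c ha hb hc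
    have ha' : a = i ∨ a = j ∨ a = k := by grind
    have hb' : b = i ∨ b = j ∨ b = k := by grind
    have hc' : c = i ∨ c = j ∨ c = k := by grind
    have he' : ∀ i w, F (e i) w (e i) = 0 := fun i w => by rw [h23, he]
    have he'' : ∀ i w, F w (e i) (e i) = 0 := fun i w => by rw [h12, he']
    (rcases ha' with rfl | rfl | rfl <;> rcases hb' with rfl | rfl | rfl <;>
      rcases hc' with rfl | rfl | rfl <;> try simp only [he, he', he'']) <;>
      first
      | done
      | exact h0
      | (rw [h12]; exact h0)
      | (rw [h23]; exact h0)
      | (rw [h12, h23]; exact h0)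
      | (rw [h23, h12]; exact h0)
      | (rw [h12, h23, h12]; exact h0)
  rw [← e.sum_repr u, ← e.sum_repr v, ← e.sum_repr w]
  simp only [map_sum, LinearMap.sum_apply, map_smul, LinearMap.smul_apply, smul_eq_mul,
    Finset.mul_sum]
  refine Finset.sum_eq_zero fun a _ => Finset.sum_eq_zero fun b _ =>
    Finset.sum_eq_zero fun c _ => ?_
  simp only [Module.Basis.coord_apply] at hu hv hw
  by_cases ha : m = a
  · subst ha; simp_all
  by_cases hb : m = b
  · subst hb; simp_all
  by_cases hc : m = c
  · subst hc; simp_all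
  rw [key c b a hc hb ha]; simp

/-! ### The Cayley cubic and singular cubics -/

variable [CharZero K]

/-- A common zero of the quadrics cutting out the nodes of the Cayley cubic is supported on one
coordinate. -/
theorem eq_zero_or_eq_zero_of_cayley {y : Fin 4 → K}
    (h0 : y 1 * y 2 + y 1 * y 3 + y 2 * y 3 = 0) (h1 : y 0 * y 2 + y 0 * y 3 + y 2 * y 3 = 0)
    (h2 : y 0 * y 1 + y 0 * y 3 + y 1 * y 3 = 0) (h3 : y 0 * y 1 + y 0 * y 2 + y 1 * y 2 = 0) :
    ∃ i, ∀ j, j ≠ i → y j = 0 := by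
  -- Each pair occurs in two hypotheses. Subtracting one of them from this sum leaves y k times the
  -- sum of the other coordinates.
  have he : y 0 * y 1 + y 0 * y 2 + y 0 * y 3 + y 1 * y 2 + y 1 * y 3 + y 2 * y 3 = 0 := by
    linear_combination (h0 + h1 + h2 + h3) / 2
  have e0 : y 0 = 0 ∨ y 1 + y 2 + y 3 = 0 := mul_eq_zero.1 (by linear_combination he - h0)
  have e1 : y 1 = 0 ∨ y 0 + y 2 + y 3 = 0 := mul_eq_zero.1 (by linear_combination he - h1)
  have e2 : y 2 = 0 ∨ y 0 + y 1 + y 3 = 0 := mul_eq_zero.1 (by linear_combination he - h2)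
  have e3 : y 3 = 0 ∨ y 0 + y 1 + y 2 = 0 := mul_eq_zero.1 (by linear_combination he - h3)
  -- Each coordinate is 0 or the total s. If s ≠ 0 and m coordinates equal s, then m s = s forces m
  -- = 1.
  have key : (y 1 = 0 ∧ y 2 = 0 ∧ y 3 = 0) ∨ (y 0 = 0 ∧ y 2 = 0 ∧ y 3 = 0) ∨
      (y 0 = 0 ∧ y 1 = 0 ∧ y 3 = 0) ∨ (y 0 = 0 ∧ y 1 = 0 ∧ y 2 = 0) := by
    grind
  rcases key with h | h | h | h
  · exact ⟨0, fun j => by fin_cases j <;> simp [h]⟩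
  · exact ⟨1, fun j => by fin_cases j <;> simp [h]⟩
  · exact ⟨2, fun j => by fin_cases j <;> simp [h]⟩
  · exact ⟨3, fun j => by fin_cases j <;> simp [h]⟩

/-- The singular points of the Cayley cubic are its four nodes. -/
theorem exists_eq_smul_of_cayley {F : V →ₗ[K] V →ₗ[K] V →ₗ[K] K} {P : K} (hP : P ≠ 0)
    (e : Module.Basis (Fin 4) K V)
    (he : ∀ i j k, F (e i) (e j) (e k) = if i ≠ j ∧ i ≠ k ∧ j ≠ k then P else 0)
    {w : V} (hw : F w w = 0) : ∃ i, ∃ c : K, w = c • e i := by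
  have key : ∀ k, F (∑ i, e.repr w i • e i) (∑ i, e.repr w i • e i) (e k) = 0 := fun k => by
    rw [e.sum_repr, hw]; rfl
  simp only [map_sum, LinearMap.sum_apply, map_smul, LinearMap.smul_apply, smul_eq_mul, he] at key
  have hP2 : 2 * P ≠ 0 := mul_ne_zero two_ne_zero hP
  obtain ⟨i, hi⟩ := eq_zero_or_eq_zero_of_cayley (y := e.repr w)
    (mul_left_cancel₀ hP2 (by
      have := key 0; simp [Fin.sum_univ_four] at this; linear_combination this))
    (mul_left_cancel₀ hP2 (by
      have := key 1; simp [Fin.sum_univ_four] at this; linear_combination this))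
    (mul_left_cancel₀ hP2 (by
      have := key 2; simp [Fin.sum_univ_four] at this; linear_combination this))
    (mul_left_cancel₀ hP2 (by
      have := key 3; simp [Fin.sum_univ_four] at this; linear_combination this))
  refine ⟨i, e.repr w i, ?_⟩
  conv_lhs => rw [← e.sum_repr w]
  exact Finset.sum_eq_single i (fun j _ hj => by rw [hi j hj, zero_smul]) (by simp)

/-- The Cayley cubic is not semi-invariant under an irreducible group. -/
theorem not_isSemiInvariant_cayley {ρ : Representation K Γ V} (hρ : SpanningOrbits ρ)
    {F : V →ₗ[K] V →ₗ[K] V →ₗ[K] K} (hF : IsSemiInvariant ρ F) {P : K} (hP : P ≠ 0)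
    (e : Module.Basis (Fin 4) K V)
    (he : ∀ i j k, F (e i) (e j) (e k) = if i ≠ j ∧ i ≠ k ∧ j ≠ k then P else 0) : False := by
  have hinj : ∀ g, Function.Injective (ρ g) := fun g x y h => by
    simpa using congrArg (ρ g⁻¹) h
  have hsum : ∀ g, ∃ c : K, ρ g (∑ i, e i) = c • ∑ i, e i := by
    intro g
    obtain ⟨χ, hχ⟩ := hF g
    have hsing : ∀ i, F (ρ g (e i)) (ρ g (e i)) = 0 := by
      intro i
      refine LinearMap.ext fun w => ?_
      obtain ⟨w, rfl⟩ : ∃ w', ρ g w' = w := ⟨ρ g⁻¹ w, by simp⟩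
      rw [hχ]
      have : F (e i) (e i) = 0 := e.ext fun k => by rw [he]; simp
      rw [this]; simp
    choose σ c hσ using fun i => exists_eq_smul_of_cayley hP e he (hsing i)
    have hc : ∀ i, c i ≠ 0 := fun i hi => by
      have h := hσ i
      rw [hi, zero_smul, ← map_zero (ρ g)] at h
      exact e.ne_zero i (hinj g h)
    have hσi : Function.Injective σ := fun i j hij => by
      by_contra hne
      have h : ρ g (c j • e i) = ρ g (c i • e j) := by
        rw [map_smul, map_smul, hσ, hσ, hij, smul_smul, smul_smul, mul_comm]
      have h' := congrArg (fun v => e.repr v i) (hinj g h)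
      simp [Ne.symm hne, hc j] at h'
    have hprod : ∀ i j k, i ≠ j → i ≠ k → j ≠ k → c i * c j * c k = χ := by
      intro i j k hij hik hjk
      have h := hχ (e i) (e j) (e k)
      simp only [hσ, map_smul, LinearMap.smul_apply, he, smul_eq_mul] at h
      rw [if_pos ⟨hσi.ne hij, hσi.ne hik, hσi.ne hjk⟩, if_pos ⟨hij, hik, hjk⟩] at h
      exact mul_right_cancel₀ hP (by linear_combination h)
    -- Compare the triples i, k, l and j, k, l, with k and l outside {i, j}.
    have heq : ∀ i j, c i = c j := by
      intro i j
      by_cases hij : i = j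
      · rw [hij]
      obtain ⟨k, l, hik, hil, hjk, hjl, hkl⟩ : ∃ k l : Fin 4,
          i ≠ k ∧ i ≠ l ∧ j ≠ k ∧ j ≠ l ∧ k ≠ l := by
        clear * - hij
        revert i j; decide
      have h := (hprod i k l hik hil hkl).trans (hprod j k l hjk hjl hkl).symm
      exact mul_right_cancel₀ (hc k) (mul_right_cancel₀ (hc l) h)
    refine ⟨c 0, ?_⟩
    rw [map_sum, Finset.smul_sum,
      ← (Finite.injective_iff_bijective.1 hσi).sum_comp fun i => c 0 • e i]
    exact Finset.sum_congr rfl fun i _ => by rw [hσ, heq i 0]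
  have hcoord : ∀ i, e.repr (∑ i, e i) i = 1 := fun i => by
    simp [Finsupp.finsetSum_apply, Finsupp.single_apply]
  have hne : (∑ i, e i) ≠ 0 := fun h => by
    have := hcoord 0
    rw [h] at this; simp at this
  have hle : (⊤ : Submodule K V) ≤ Submodule.span K {∑ i, e i} := by
    rw [← hρ _ hne, Submodule.span_le]
    rintro _ ⟨g, rfl⟩
    obtain ⟨c, hc⟩ := hsum g
    exact Submodule.mem_span_singleton.2 ⟨c, hc.symm⟩
  obtain ⟨c, hc⟩ := Submodule.mem_span_singleton.1 (hle (Submodule.mem_top (x := e 0)))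
  have h0 : c = 1 := by
    have := congrArg (fun v => e.repr v 0) hc
    simpa [-map_sum, hcoord] using this
  have h1 : c = 0 := by
    have := congrArg (fun v => e.repr v 1) hc
    simpa [-map_sum, hcoord] using this
  exact one_ne_zero (h0.symm.trans h1)

/-- A non-zero semi-invariant cubic form of an irreducible group of rank four is smooth. -/
theorem IsSemiInvariant.eq_zero_of_singular [FiniteDimensional K V]
    (hn : Module.finrank K V = 4) {ρ : Representation K Γ V} (hρ : SpanningOrbits ρ)
    {F : V →ₗ[K] V →ₗ[K] V →ₗ[K] K} (hF : IsSemiInvariant ρ F)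
    (h12 : ∀ u v w, F u v w = F v u w) (h23 : ∀ u v w, F u v w = F u w v)
    {v : V} (hv : v ≠ 0) (hs : F v v = 0) : F = 0 := by
  obtain ⟨e, he⟩ := exists_basis_mem_of_span_eq_top hn (hρ v hv)
  have he0 : ∀ i w, F (e i) (e i) w = 0 := by
    intro i w
    obtain ⟨g, hg⟩ := he i
    obtain ⟨χ, hχ⟩ := hF g
    obtain ⟨w, rfl⟩ : ∃ w', ρ g w' = w := ⟨ρ g⁻¹ w, by simp⟩
    rw [← hg, hχ, hs]; simp
  by_cases hz : ∃ i j k m : Fin 4, i ≠ j ∧ i ≠ k ∧ j ≠ k ∧ m ≠ i ∧ m ≠ j ∧ m ≠ k ∧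
      F (e i) (e j) (e k) = 0
  · obtain ⟨i, j, k, m, hij, hik, hjk, hmi, hmj, hmk, h0⟩ := hz
    refine hF.eq_zero_of_vanishes_on_ker hn hρ (l := e.coord m) (fun h => ?_)
      (trilinear_vanishes_on_coord_ker h12 h23 e he0 hij hik hjk hmi hmj hmk h0)
    simpa using LinearMap.congr_fun h (e m)
  · push Not at hz
    exfalso
    -- `a i` is the coefficient omitting index i. Scaling each e i by `a i` turns every coefficient
    -- into the product of all four.
    let a : Fin 4 → K := ![F (e 1) (e 2) (e 3), F (e 0) (e 2) (e 3), F (e 0) (e 1) (e 3),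
      F (e 0) (e 1) (e 2)]
    have ha : ∀ i, a i ≠ 0 := by
      intro i
      fin_cases i
      · exact hz 1 2 3 0 (by decide) (by decide) (by decide) (by decide) (by decide) (by decide)
      · exact hz 0 2 3 1 (by decide) (by decide) (by decide) (by decide) (by decide) (by decide)
      · exact hz 0 1 3 2 (by decide) (by decide) (by decide) (by decide) (by decide) (by decide)
      · exact hz 0 1 2 3 (by decide) (by decide) (by decide) (by decide) (by decide) (by decide)
    refine not_isSemiInvariant_cayley hρ hF (P := a 0 * a 1 * a 2 * a 3)
      (mul_ne_zero (mul_ne_zero (mul_ne_zero (ha 0) (ha 1)) (ha 2)) (ha 3))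
      (e.isUnitSMul fun i => (ha i).isUnit) fun i j k => ?_
    simp only [Module.Basis.isUnitSMul_apply, map_smul, LinearMap.smul_apply, smul_eq_mul]
    have he' : ∀ i w, F (e i) w (e i) = 0 := fun i w => by rw [h23, he0]
    have he'' : ∀ i w, F w (e i) (e i) = 0 := fun i w => by rw [h12, he']
    by_cases hij : i = j
    · simp [hij, he0]
    by_cases hik : i = k
    · simp [hik, he']
    by_cases hjk : j = k
    · simp [hjk, he'']
    rw [if_pos ⟨hij, hik, hjk⟩]
    -- The guards j < i let `simp` sort the indices without looping.
    have s12 : ∀ i j w, j < i → F (e i) (e j) w = F (e j) (e i) w := fun _ _ _ _ => h12 _ _ _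
    have s23 : ∀ u i j, j < i → F u (e i) (e j) = F u (e j) (e i) := fun _ _ _ _ => h23 _ _ _
    fin_cases i <;> fin_cases j <;> fin_cases k <;>
      first
      | exact absurd rfl hij
      | exact absurd rfl hik
      | exact absurd rfl hjk
      | (simp [a, s12, s23, h12 (e 1) (e 0)]; ring)

end SymmetricTrilinear
-- Semi-invariance of the equation
section InvariantSurface

open MvPolynomial

variable {K σ : Type*} [Field K]

/-- By the Nullstellensatz, a squarefree polynomial divides every polynomial vanishing on its
zero locus. -/
theorem Squarefree.dvd_of_forall_eval_eq_zero [IsAlgClosed K] [Finite σ] {f h : MvPolynomial σ K}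
    (hf : Squarefree f) (H : ∀ x, eval x f = 0 → eval x h = 0) : f ∣ h := by
  have : h ∈ vanishingIdeal K (zeroLocus K (Ideal.span {f})) := by
    rw [mem_vanishingIdeal_iff]
    intro x hx
    rw [mem_zeroLocus_iff] at hx
    simpa [aeval_eq_eval] using H x (by
      simpa [aeval_eq_eval] using hx f (Ideal.mem_span_singleton_self f))
  rw [vanishingIdeal_zeroLocus_eq_radical] at this
  obtain ⟨n, hn⟩ := this
  exact hf.isRadical n h (Ideal.mem_span_singleton.1 hn)

theorem MvPolynomial.IsHomogeneous.eval_smul {f : MvPolynomial σ K} {d : ℕ}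
    (hf : f.IsHomogeneous d) (c : K) (x : σ → K) : eval (c • x) f = c ^ d * eval x f := by
  rw [eval_eq, eval_eq, Finset.mul_sum]
  refine Finset.sum_congr rfl fun m hm => ?_
  have hd : ∑ i ∈ m.support, m i = d := by
    simpa [Finsupp.weight_apply, Finsupp.sum] using hf (mem_support_iff.1 hm)
  simp only [Pi.smul_apply, smul_eq_mul, mul_pow, Finset.prod_mul_distrib,
    Finset.prod_pow_eq_pow_sum, hd]
  ring

theorem IsReducedEquation.mk_mem_iff {f : MvPolynomial (Fin 4) ℂ} {d : ℕ}
    {S : Set (ℙ ℂ (Fin 4 → ℂ))} (hf : IsReducedEquation f d S) {x : Fin 4 → ℂ} (hx : x ≠ 0) :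
    Projectivization.mk ℂ x hx ∈ S ↔ eval x f = 0 := by
  obtain ⟨a, ha⟩ := Projectivization.exists_smul_eq_mk_rep ℂ x hx
  rw [← hf.zeroLocus, projZeroLocus, Set.mem_ofPred_eq, ← ha, Units.smul_def,
    hf.homogeneous.eval_smul]
  simp

theorem IsReducedEquation.ne_zero {f : MvPolynomial (Fin 4) ℂ} {d : ℕ}
    {S : Set (ℙ ℂ (Fin 4 → ℂ))} (hf : IsReducedEquation f d S) : f ≠ 0 :=
  hf.squarefree.ne_zero

/-- The equation of an invariant surface is semi-invariant. -/
theorem IsReducedEquation.exists_eval_mulVec {f : MvPolynomial (Fin 4) ℂ} {d : ℕ}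
    {S : Set (ℙ ℂ (Fin 4 → ℂ))} (hf : IsReducedEquation f d S)
    {G : Subgroup (Matrix.SpecialLinearGroup (Fin 4) ℂ)}
    (hinv : IsInvariantUnder (G.map Matrix.SpecialLinearGroup.toPGL) S)
    {g : Matrix.SpecialLinearGroup (Fin 4) ℂ} (hg : g ∈ G) :
    ∃ c : ℂ, ∀ x, eval ((g : Matrix (Fin 4) (Fin 4) ℂ) *ᵥ x) f = c * eval x f := by
  have hzero : ∀ x, eval x f = 0 → eval ((g : Matrix (Fin 4) (Fin 4) ℂ) *ᵥ x) f = 0 := by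
    intro x hx
    by_cases h0 : x = 0
    · rw [h0, Matrix.mulVec_zero, ← h0, hx]
    have hmem := Set.smul_mem_smul_set (a := Matrix.SpecialLinearGroup.toPGL g)
      ((hf.mk_mem_iff h0).2 hx)
    rw [hinv _ (Subgroup.mem_map_of_mem _ hg)] at hmem
    exact (hf.mk_mem_iff _).1 hmem
  let h : MvPolynomial (Fin 4) ℂ :=
    aeval (fun i => ∑ j, C ((g : Matrix (Fin 4) (Fin 4) ℂ) i j) * X j) f
  have heval : ∀ x, eval x h = eval ((g : Matrix (Fin 4) (Fin 4) ℂ) *ᵥ x) f := by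
    intro x
    rw [← aeval_eq_eval, ← aeval_eq_eval]
    simp only [h, ← AlgHom.comp_apply, comp_aeval]
    congr 2
    ext i
    simp [Matrix.mulVec, dotProduct]
  have hhom : h.IsHomogeneous d := by
    rw [← one_mul d]
    exact hf.homogeneous.aeval (n := 1)
      (fun i => ∑ j, C ((g : Matrix (Fin 4) (Fin 4) ℂ) i j) * X j) fun i => IsHomogeneous.sum _ _ _ fun j _ => isHomogeneous_C_mul_X _ _
  obtain ⟨q, hq⟩ := hf.squarefree.dvd_of_forall_eval_eq_zero fun x hx =>
    (heval x).trans (hzero x hx)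
  -- The translate h, if non-zero, has the same degree as f, so the quotient is constant.
  obtain ⟨c, hc⟩ : ∃ c, q = C c := by
    by_cases hq0 : q = 0
    · exact ⟨0, by simp [hq0]⟩
    have hd := totalDegree_mul_of_isDomain hf.ne_zero hq0
    rw [← hq, hhom.totalDegree (by rw [hq]; exact mul_ne_zero hf.ne_zero hq0),
      hf.homogeneous.totalDegree hf.ne_zero] at hd
    exact ⟨_, totalDegree_eq_zero_iff_eq_C.1 (by omega)⟩
  exact ⟨c, fun x => by rw [← heval, hq, hc, map_mul, eval_C, mul_comm]⟩

/-- The commutator of two derivations is a derivation, and this one kills the variables. -/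
theorem MvPolynomial.pderiv_comm (i j : σ) (f : MvPolynomial σ K) :
    pderiv i (pderiv j f) = pderiv j (pderiv i f) := by
  have : ⁅(pderiv i : Derivation K (MvPolynomial σ K) (MvPolynomial σ K)),
      (pderiv j : Derivation K (MvPolynomial σ K) (MvPolynomial σ K))⁆ = 0 := by
    classical
    refine MvPolynomial.derivation_ext fun k => ?_
    rw [Derivation.commutator_apply, pderiv_X, pderiv_X]
    simp only [Pi.single_apply]
    split_ifs <;> simp
  have h := congrArg (fun D : Derivation K (MvPolynomial σ K) (MvPolynomial σ K) => D f) this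
  simpa [Derivation.commutator_apply, sub_eq_zero] using h

theorem MvPolynomial.IsHomogeneous.eval_eq_of_zero {f : MvPolynomial σ K}
    (hf : f.IsHomogeneous 0) (x y : σ → K) : eval x f = eval y f := by
  rw [totalDegree_eq_zero_iff_eq_C.1 ((totalDegree_zero_iff_isHomogeneous σ).2 hf), eval_C, eval_C]

theorem MvPolynomial.IsHomogeneous.sum_mul_eval_pderiv [Fintype σ] {f : MvPolynomial σ K} {d : ℕ}
    (hf : f.IsHomogeneous d) (x : σ → K) :
    ∑ i, x i * eval x (pderiv i f) = d * eval x f := by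
  simpa using congrArg (eval x) hf.sum_X_mul_pderiv

/-! ### Polar forms of quadrics and cubics -/

variable [Fintype σ]

/-- The bilinear form of second derivatives at the origin. -/
noncomputable def hessianForm (f : MvPolynomial σ K) : (σ → K) →ₗ[K] (σ → K) →ₗ[K] K :=
  ∑ i, ∑ j, (LinearMap.proj i).smulRight
    (eval 0 (pderiv i (pderiv j f)) • (LinearMap.proj j : (σ → K) →ₗ[K] K))

theorem hessianForm_apply (f : MvPolynomial σ K) (u v : σ → K) :
    hessianForm f u v = ∑ i, ∑ j, u i * (eval 0 (pderiv i (pderiv j f)) * v j) := by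
  simp [hessianForm]

/-- The trilinear form of third derivatives at the origin. -/
noncomputable def thirdDerivForm (f : MvPolynomial σ K) :
    (σ → K) →ₗ[K] (σ → K) →ₗ[K] (σ → K) →ₗ[K] K :=
  ∑ k, (LinearMap.proj k).smulRight (hessianForm (pderiv k f))

theorem thirdDerivForm_apply (f : MvPolynomial σ K) (u v w : σ → K) :
    thirdDerivForm f u v w = ∑ k, u k * hessianForm (pderiv k f) v w := by
  simp [thirdDerivForm]

theorem hessianForm_comm (f : MvPolynomial σ K) (u v : σ → K) :
    hessianForm f u v = hessianForm f v u := by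
  rw [hessianForm_apply, hessianForm_apply, Finset.sum_comm]
  refine Finset.sum_congr rfl fun i _ => Finset.sum_congr rfl fun j _ => ?_
  rw [pderiv_comm]; ring

theorem thirdDerivForm_swap_right (f : MvPolynomial σ K) (u v w : σ → K) :
    thirdDerivForm f u v w = thirdDerivForm f u w v := by
  simp only [thirdDerivForm_apply]
  exact Finset.sum_congr rfl fun i _ => by rw [hessianForm_comm]

theorem thirdDerivForm_swap_left (f : MvPolynomial σ K) (u v w : σ → K) :
    thirdDerivForm f u v w = thirdDerivForm f v u w := by
  simp only [thirdDerivForm_apply, hessianForm_apply, Finset.mul_sum]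
  rw [Finset.sum_comm]
  refine Finset.sum_congr rfl fun i _ => Finset.sum_congr rfl fun j _ =>
    Finset.sum_congr rfl fun k _ => ?_
  rw [pderiv_comm k j, pderiv_comm i j, pderiv_comm i k]; ring

/-- Euler's identity for the linear forms ∂f/∂x_j; second derivatives are constant, so evaluating
them at 0 loses nothing. -/
theorem hessianForm_eq_sum_eval_pderiv {f : MvPolynomial σ K} (hf : f.IsHomogeneous 2)
    (u v : σ → K) : hessianForm f u v = ∑ j, eval u (pderiv j f) * v j := by
  rw [hessianForm_apply, Finset.sum_comm]
  refine Finset.sum_congr rfl fun j _ => ?_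
  have h := (hf.pderiv (i := j)).sum_mul_eval_pderiv u
  rw [Nat.cast_one, one_mul] at h
  rw [← h, Finset.sum_mul]
  refine Finset.sum_congr rfl fun i _ => ?_
  rw [(hf.pderiv (i := j)).pderiv.eval_eq_of_zero u 0]; ring

theorem hessianForm_self {f : MvPolynomial σ K} (hf : f.IsHomogeneous 2) (v : σ → K) :
    hessianForm f v v = 2 * eval v f := by
  rw [hessianForm_eq_sum_eval_pderiv hf, ← Nat.cast_two, ← hf.sum_mul_eval_pderiv]
  exact Finset.sum_congr rfl fun _ _ => mul_comm _ _

/-- Translates a vanishing gradient at v into F v v = 0. -/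
theorem thirdDerivForm_self_left {f : MvPolynomial σ K} (hf : f.IsHomogeneous 3) (v w : σ → K) :
    thirdDerivForm f v v w = 2 * ∑ k, w k * eval v (pderiv k f) := by
  rw [thirdDerivForm_swap_right, thirdDerivForm_swap_left, thirdDerivForm_apply, Finset.mul_sum]
  refine Finset.sum_congr rfl fun k _ => ?_
  rw [hessianForm_self hf.pderiv]; ring

theorem thirdDerivForm_self {f : MvPolynomial σ K} (hf : f.IsHomogeneous 3) (v : σ → K) :
    thirdDerivForm f v v v = 6 * eval v f := by
  rw [thirdDerivForm_self_left hf, hf.sum_mul_eval_pderiv]; push_cast; ring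

variable [CharZero K]

/-- Writing the polar form through values of f, here and in degree 3, transfers semi-invariance
without a chain rule. -/
theorem hessianForm_polarization {f : MvPolynomial σ K} (hf : f.IsHomogeneous 2) (u v : σ → K) :
    hessianForm f u v = eval (u + v) f - eval u f - eval v f := by
  have h := hessianForm_self hf (u + v)
  simp only [map_add, LinearMap.add_apply, hessianForm_self hf, hessianForm_comm f v u] at h
  linear_combination h / 2

theorem thirdDerivForm_polarization {f : MvPolynomial σ K} (hf : f.IsHomogeneous 3)
    (u v w : σ → K) : thirdDerivForm f u v w =
      eval (u + v + w) f - eval (u + v) f - eval (u + w) f - eval (v + w) f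
        + eval u f + eval v f + eval w f := by
  have h1 := thirdDerivForm_self hf (u + v + w)
  have h2 := thirdDerivForm_self hf (u + v)
  have h3 := thirdDerivForm_self hf (u + w)
  have h4 := thirdDerivForm_self hf (v + w)
  have s1 := thirdDerivForm_swap_left f
  have s2 := thirdDerivForm_swap_right f
  simp only [map_add, LinearMap.add_apply, thirdDerivForm_self hf, s1 v u, s1 w u, s1 w v,
    fun x => s2 x v u, fun x => s2 x w u, fun x => s2 x w v] at h1 h2 h3 h4
  linear_combination (h1 - h2 - h3 - h4) / 6

end InvariantSurface

/-! ### Singular semi-invariant forms of degree at most three -/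

section Smoothness

open MvPolynomial

/-- The representation on column vectors of a subgroup of the special linear group. -/
def mulVecRepresentation (G : Subgroup (Matrix.SpecialLinearGroup (Fin 4) ℂ)) :
    Representation ℂ G (Fin 4 → ℂ) where
  toFun g := Matrix.mulVecLin (g : Matrix.SpecialLinearGroup (Fin 4) ℂ).1
  map_one' := by simp; rfl
  map_mul' g h := by simp [Matrix.mulVecLin_mul]; rfl

theorem ActsTransitively.spanningOrbits {G : Subgroup (Matrix.SpecialLinearGroup (Fin 4) ℂ)}
    (hG : ActsTransitively G) : SpanningOrbits (mulVecRepresentation G) := by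
  intro x hx
  rw [← hG x hx]
  congr 1
  ext y
  simp only [Set.mem_range, Subtype.exists, Set.mem_ofPred_eq]
  exact exists_congr fun g => ⟨fun ⟨h, e⟩ => ⟨h, e.symm⟩, fun ⟨h, e⟩ => ⟨h, e.symm⟩⟩

/-- A semi-invariant form of degree at most three with a singular point is zero. -/
theorem eq_zero_of_singular_of_degree_lt_four
    {G : Subgroup (Matrix.SpecialLinearGroup (Fin 4) ℂ)} (hG : ActsTransitively G)
    {f : MvPolynomial (Fin 4) ℂ} {d : ℕ} (hd : 0 < d) (hd4 : d < 4) (hf : f.IsHomogeneous d)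
    (hinv : ∀ g ∈ G, ∃ c : ℂ, ∀ x,
      eval ((g : Matrix (Fin 4) (Fin 4) ℂ) *ᵥ x) f = c * eval x f)
    {v : Fin 4 → ℂ} (hv : v ≠ 0) (hs : ∀ i, eval v (pderiv i f) = 0) : f = 0 := by
  have hρ := hG.spanningOrbits
  suffices h : ∀ x, eval x f = 0 from MvPolynomial.funext fun x => by rw [h, map_zero]
  obtain rfl | rfl | rfl : d = 1 ∨ d = 2 ∨ d = 3 := by omega
  · intro x
    have h := hf.sum_mul_eval_pderiv x
    simp only [hf.pderiv.eval_eq_of_zero x v, hs] at h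
    simpa using h.symm
  · have hB : ∀ g : G, ∃ c : ℂ, ∀ u w, hessianForm f (mulVecRepresentation G g u)
        (mulVecRepresentation G g w) = c * hessianForm f u w := by
      rintro ⟨g, hg⟩
      obtain ⟨c, hc⟩ := hinv g hg
      have hc' : ∀ x, eval (mulVecRepresentation G ⟨g, hg⟩ x) f = c * eval x f := hc
      exact ⟨c, fun u w => by simp only [hessianForm_polarization hf, ← map_add, hc']; ring⟩
    -- The radical of the quadratic form is G-stable and contains v.
    have hle : (⊤ : Submodule ℂ (Fin 4 → ℂ)) ≤ LinearMap.ker (hessianForm f) := by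
      rw [← hρ v hv, Submodule.span_le]
      rintro _ ⟨g, rfl⟩
      refine LinearMap.ext fun w => ?_
      obtain ⟨w, rfl⟩ : ∃ w', mulVecRepresentation G g w' = w :=
        ⟨mulVecRepresentation G g⁻¹ w, by simp⟩
      obtain ⟨c, hc⟩ := hB g
      rw [hc, hessianForm_eq_sum_eval_pderiv hf]
      simp [hs]
    intro x
    have h := hessianForm_self hf x
    rw [LinearMap.mem_ker.1 (hle (Submodule.mem_top (x := x)))] at h
    simpa using h.symm
  · have hF : IsSemiInvariant (mulVecRepresentation G) (thirdDerivForm f) := by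
      rintro ⟨g, hg⟩
      obtain ⟨c, hc⟩ := hinv g hg
      have hc' : ∀ x, eval (mulVecRepresentation G ⟨g, hg⟩ x) f = c * eval x f := hc
      exact ⟨c, fun u v w => by
        simp only [thirdDerivForm_polarization hf, ← map_add, hc']; ring⟩
    have h0 := hF.eq_zero_of_singular (by simp) hρ (thirdDerivForm_swap_left f)
      (thirdDerivForm_swap_right f) hv
      (LinearMap.ext fun w => by rw [thirdDerivForm_self_left hf]; simp [hs])
    intro x
    have h := thirdDerivForm_self hf x
    rw [h0] at h
    simpa using h.symm

end Smoothness

theorem mainTheorem7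
    (G : Subgroup (Matrix.SpecialLinearGroup (Fin 4) ℂ)) (hfin : Finite G)
    (htrans : ActsTransitively G)
    (S : Set (ℙ ℂ (Fin 4 → ℂ))) (d : ℕ)
    (hS : IsSurfaceOfDegree S d)
    (hinv : IsInvariantUnder (G.map Matrix.SpecialLinearGroup.toPGL) S)
    (hmin : ∀ (S' : Set (ℙ ℂ (Fin 4 → ℂ))) (d' : ℕ), IsSurfaceOfDegree S' d' →
      IsInvariantUnder (G.map Matrix.SpecialLinearGroup.toPGL) S' → d ≤ d') :
    4 ≤ d ∨ IsSmoothSurface S := by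
  obtain ⟨f, hf⟩ := hS
  refine or_iff_not_imp_left.2 fun hd => ⟨f, d, hf, fun p _ => ?_⟩
  by_contra! hs
  exact hf.ne_zero (eq_zero_of_singular_of_degree_lt_four htrans hf.pos (not_le.1 hd)
    hf.homogeneous (fun g hg => hf.exists_eval_mulVec hinv hg) p.rep_nonzero hs)
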